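/- Let $n\ge 2$, $1\le k\le n-1$ and $m$ be integers with $m\ge 1$, and let $M$ be a smooth $n$-dimensional manifold (without boundary). Let $\omega$ be an $\mathbb{R}^m$-valued $k$-plectic form on $M$: a smooth section of $\bigwedge^{k+1}T^*M\otimes\mathbb{R}^m$ that is closed, $d\omega=0$, and nondegenerate at every point $x\in M$, i.e. if $v\in T_xM$ satisfies $\omega_x(v,u_1,\dots,u_k)=0$ for all $u_1,\dots,u_k\in T_xM$, then $v=0$. Let $X=\bigwedge^kT^*M\otimes\mathbb{R}^m$ be the total space of the vector bundle of $\mathbb{R}^m$-valued alternating $k$-forms on the tangent spaces of $M$, with projection $\pi:X\to M$. Let $\Theta$ be the canonical $\mathbb{R}^m$-valued $k$-form on $X$, given for $(x,\eta)\in X$ and $v_1,\dots,v_k\in T_{(x,\eta)}X$ by $$\Theta_{(x,\eta)}(v_1,\dots,v_k)=\eta(\pi_*v_1,\dots,\pi_*v_k),$$ and let $\Omega=d\Theta$. Then every point $x_0\in M$ has an open neighbourhood $U$ with a smooth embedding $f:U\to X$ such that $\omega|_U=f^*\Omega$. More precisely, $U$ and $f$ can be chosen so that there is a smooth $\mathbb{R}^m$-valued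 $k$-form $\alpha$ on $U$ with $d\alpha=\omega|_U$ and $f(x)=(x,\alpha_x)$ for all $x\in U$. -/

import Mathlib

open Set Bundle Manifold
open scoped Manifold ContDiff Topology

noncomputable section

namespace Multisymplectic

section Pullback

variable {E E' F : Type*} [NormedAddCommGroup E] [NormedSpace ℝ E]
  [NormedAddCommGroup E'] [NormedSpace ℝ E'] [NormedAddCommGroup F] [NormedSpace ℝ F]

/-- Normalised antisymmetrisation of a continuous multilinear map (a helper for the smoothness of
the transition functions below). -/
def alternatizeCLM (k : ℕ) :
    ContinuousMultilinearMap ℝ (fun _ : Fin k ↦ E) F →L[ℝ] E [⋀^Fin k]→L[ℝ] F :=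
  LinearMap.mkContinuous
    { toFun := fun f ↦ ((k.factorial : ℝ)⁻¹) • ContinuousMultilinearMap.alternatization f
      map_add' := fun f g ↦ by simp
      map_smul' := fun c f ↦ by
        ext v
        simp only [ContinuousAlternatingMap.smul_apply,
          ContinuousMultilinearMap.alternatization_apply_apply,
          smul_apply, RingHom.id_apply, Finset.smul_sum]
        refine Finset.sum_congr rfl fun σ _ ↦ ?_
        simp only [smul_comm c] }
    1 (fun f ↦ by
      refine ContinuousAlternatingMap.opNorm_le_bound _ (by positivity) fun v ↦ ?_
      have hk : (0 : ℝ) < k.factorial := by positivity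
      have h : ‖∑ σ : Equiv.Perm (Fin k), Equiv.Perm.sign σ • f (v ∘ σ)‖
          ≤ ∑ _σ : Equiv.Perm (Fin k), ‖f‖ * ∏ i, ‖v i‖ := by
        refine norm_sum_le_of_le _ fun σ _ ↦ ?_
        have h1 : ‖Equiv.Perm.sign σ • f (v ∘ σ)‖ = ‖f (v ∘ σ)‖ := by
          rcases Int.units_eq_one_or (Equiv.Perm.sign σ) with h | h <;> simp [h]
        rw [h1]
        refine (f.le_opNorm _).trans (le_of_eq ?_)
        congr 1
        exact Equiv.prod_comp σ (fun i ↦ ‖v i‖)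
      simp only [Finset.sum_const, Finset.card_univ, Fintype.card_perm, Fintype.card_fin,
        nsmul_eq_mul] at h
      simp only [LinearMap.coe_mk, AddHom.coe_mk, ContinuousAlternatingMap.smul_apply,
        ContinuousMultilinearMap.alternatization_apply_apply, norm_smul, norm_inv,
        Real.norm_natCast, one_mul]
      rw [inv_mul_le_iff₀ hk]
      exact h)

theorem alternatizeCLM_coe (k : ℕ) (f : E [⋀^Fin k]→L[ℝ] F) :
    alternatizeCLM k f.toContinuousMultilinearMap = f := by
  ext v
  have hk : (k.factorial : ℝ) ≠ 0 := by positivity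
  have h : ∀ σ : Equiv.Perm (Fin k), Equiv.Perm.sign σ • f (v ∘ σ) = f v := fun σ ↦ by
    have := f.toAlternatingMap.map_perm v σ
    simp only [ContinuousAlternatingMap.coe_toAlternatingMap] at this
    rw [this, smul_smul, Int.units_mul_self, one_smul]
  simp only [alternatizeCLM, LinearMap.mkContinuous_apply, LinearMap.coe_mk, AddHom.coe_mk,
    ContinuousAlternatingMap.smul_apply, ContinuousMultilinearMap.alternatization_apply_apply,
    ContinuousAlternatingMap.coe_toContinuousMultilinearMap, h, Finset.sum_const,
    Finset.card_univ, Fintype.card_perm, Fintype.card_fin]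
  rw [← Nat.cast_smul_eq_nsmul ℝ, smul_smul, inv_mul_cancel₀ hk, one_smul]

/-- The linear pullback `g ↦ g^*` on alternating maps depends smoothly on `g`. -/
theorem contDiff_compContinuousLinearMapCLM (k : ℕ) (r : ℕ∞ω) :
    ContDiff ℝ r (fun g : E →L[ℝ] E' ↦
      (ContinuousAlternatingMap.compContinuousLinearMapCLM g :
        (E' [⋀^Fin k]→L[ℝ] F) →L[ℝ] (E [⋀^Fin k]→L[ℝ] F))) := by
  have h : ContDiff ℝ r (fun g : E →L[ℝ] E' ↦
      ContinuousMultilinearMap.compContinuousLinearMapContinuousMultilinear ℝ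
        (fun _ : Fin k ↦ E) (fun _ : Fin k ↦ E') F (fun _ ↦ g)) :=
    (ContinuousMultilinearMap.contDiff _).comp (contDiff_pi.2 fun _ ↦ contDiff_id)
  have h2 := (contDiff_const (c := alternatizeCLM (E := E) (F := F) k)).clm_comp
    (h.clm_comp (contDiff_const (c :=
      ContinuousAlternatingMap.toContinuousMultilinearMapCLM (𝕜 := ℝ) (E := E') (F := F)
        (ι := Fin k) ℝ)))
  convert h2 using 1
  funext g
  ext1 f
  exact (alternatizeCLM_coe k (f.compContinuousLinearMap g)).symm

end Pullback

variable {E : Type*} [NormedAddCommGroup E] [NormedSpace ℝ E] {H : Type*} [TopologicalSpace H]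
  (I : ModelWithCorners ℝ E H) {M : Type*} [TopologicalSpace M] [ChartedSpace H M]
  {E' : Type*} [NormedAddCommGroup E'] [NormedSpace ℝ E'] {H' : Type*} [TopologicalSpace H']
  (I' : ModelWithCorners ℝ E' H') {M' : Type*} [TopologicalSpace M'] [ChartedSpace H' M']
  (k : ℕ) (F : Type*) [NormedAddCommGroup F] [NormedSpace ℝ F]

/-- The fibre `⋀ᵏ T_x^*M ⊗ F` of the bundle of `F`-valued alternating `k`-forms, realised as the
space of alternating `k`-linear maps `T_xM × ⋯ × T_xM → F`. -/
abbrev FormSpace (x : M) : Type _ := TangentSpace I x [⋀^Fin k]→L[ℝ] F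

/-- Transition functions of `⋀ᵏ T^*M ⊗ F`: pullback by the transition functions of `TM`. -/
def formBundleCore (M : Type*) [TopologicalSpace M] [ChartedSpace H M] [IsManifold I ∞ M] :
    VectorBundleCore ℝ M (E [⋀^Fin k]→L[ℝ] F) (atlas H M) where
  baseSet i := i.1.source
  isOpen_baseSet i := i.1.open_source
  indexAt := achart H
  mem_baseSet_at := mem_chart_source H
  coordChange i j x :=
    ContinuousAlternatingMap.compContinuousLinearMapCLM ((tangentBundleCore I M).coordChange j i x)
  coordChange_self i x hx η := by
    ext v
    simp only [ContinuousAlternatingMap.compContinuousLinearMapCLM_apply,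
      ContinuousAlternatingMap.compContinuousLinearMap_apply]
    congr 1
    funext l
    exact (tangentBundleCore I M).coordChange_self i x hx (v l)
  continuousOn_coordChange i j := by
    refine (contDiff_compContinuousLinearMapCLM (E := E) (E' := E) (F := F) k 0).continuous
      |>.comp_continuousOn ?_
    rw [inter_comm]
    exact (tangentBundleCore I M).continuousOn_coordChange j i
  coordChange_comp i j l x hx η := by
    ext v
    simp only [ContinuousAlternatingMap.compContinuousLinearMapCLM_apply,
      ContinuousAlternatingMap.compContinuousLinearMap_apply]
    congr 1
    funext a
    exact (tangentBundleCore I M).coordChange_comp l j i x ⟨⟨hx.2, hx.1.2⟩, hx.1.1⟩ (v a)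

section BundleInstances

variable [IsManifold I ∞ M]

instance : TopologicalSpace
    (TotalSpace (E [⋀^Fin k]→L[ℝ] F) (FormSpace I k F : M → Type _)) :=
  inferInstanceAs <| TopologicalSpace (formBundleCore I k F M).TotalSpace

instance : FiberBundle (E [⋀^Fin k]→L[ℝ] F) (FormSpace I k F : M → Type _) :=
  inferInstanceAs <| FiberBundle (E [⋀^Fin k]→L[ℝ] F) (formBundleCore I k F M).Fiber

instance : VectorBundle ℝ (E [⋀^Fin k]→L[ℝ] F) (FormSpace I k F : M → Type _) :=
  inferInstanceAs <| VectorBundle ℝ (E [⋀^Fin k]→L[ℝ] F) (formBundleCore I k F M).Fiber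

instance : (formBundleCore I k F M).IsContMDiff I ∞ where
  contMDiffOn_coordChange i j := by
    have : IsManifold I (∞ + 1) M := ‹IsManifold I ∞ M›
    have h : (tangentBundleCore I M).IsContMDiff I ∞ := tangentBundleCore.isContMDiff
    have h1 := h.contMDiffOn_coordChange j i
    rw [inter_comm] at h1
    exact (contDiff_compContinuousLinearMapCLM (E := E) (E' := E) (F := F) k ∞).contMDiff
      |>.comp_contMDiffOn h1

instance : ContMDiffVectorBundle ∞ (E [⋀^Fin k]→L[ℝ] F) (FormSpace I k F : M → Type _) I :=
  inferInstanceAs <|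
    ContMDiffVectorBundle ∞ (E [⋀^Fin k]→L[ℝ] F) (formBundleCore I k F M).Fiber I

end BundleInstances

/-- The total space `X = ⋀ᵏ T^*M ⊗ F`, a smooth manifold modelled on `E × (⋀ᵏ E^* ⊗ F)`. -/
abbrev FormBundle (M : Type*) [TopologicalSpace M] [ChartedSpace H M] : Type _ :=
  TotalSpace (E [⋀^Fin k]→L[ℝ] F) (FormSpace I k F : M → Type _)

/-- The model with corners of the total space `⋀ᵏ T^*M ⊗ F`. -/
abbrev formModel : ModelWithCorners ℝ (E × (E [⋀^Fin k]→L[ℝ] F))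
    (ModelProd H (E [⋀^Fin k]→L[ℝ] F)) :=
  I.prod 𝓘(ℝ, E [⋀^Fin k]→L[ℝ] F)

/-- `F`-valued differential `k`-forms on `M` (no regularity imposed). -/
abbrev DiffForm (M : Type*) [TopologicalSpace M] [ChartedSpace H M] : Type _ :=
  ∀ x : M, FormSpace I k F x

variable {k F}

/-- A differential form is smooth on `s` if it is a smooth section of `⋀ᵏ T^*M ⊗ F` over `s`. -/
def SmoothOn [IsManifold I ∞ M] (w : DiffForm I k F M) (s : Set M) : Prop :=
  ContMDiffOn I (formModel I k F) ∞ (fun x ↦ (⟨x, w x⟩ : FormBundle I k F M)) s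

/-- The pullback `f^* w` of a differential form under a map of manifolds. -/
def pullback (f : M → M') (w : DiffForm I' k F M') : DiffForm I k F M :=
  fun x ↦ (w (f x)).compContinuousLinearMap (mfderiv I I' f x)

/-- The expression of a differential form in the preferred chart `φ` at `x₀`:
the form `(φ⁻¹)^* w` on the model vector space. -/
def inChart (w : DiffForm I k F M) (x₀ : M) : E → E [⋀^Fin k]→L[ℝ] F :=
  fun u ↦ (w ((extChartAt I x₀).symm u)).compContinuousLinearMap
    (mfderivWithin 𝓘(ℝ, E) I (extChartAt I x₀).symm (range I) u)

/-- The exterior derivative of a differential form on a manifold, computed at `x` in the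
preferred chart `φ` at `x`: `(dw)_x = φ^* (d ((φ⁻¹)^* w))`. -/
def extDer (w : DiffForm I k F M) : DiffForm I (k + 1) F M :=
  fun x ↦ (extDerivWithin (inChart I w x) (range I) (extChartAt I x x)).compContinuousLinearMap
    (mfderiv I 𝓘(ℝ, E) (extChartAt I x) x)

/-- Nondegeneracy of a vector-valued `(k+1)`-form on a vector space: `w(v, u₁, …, u_k) = 0` for
all `u₁, …, u_k` only if `v = 0`. -/
def Nondegenerate {V : Type*} [AddCommGroup V] [Module ℝ V] [TopologicalSpace V]
    (w : V [⋀^Fin (k + 1)]→L[ℝ] F) : Prop :=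
  ∀ v : V, (∀ u : Fin k → V, w (Fin.cons v u) = 0) → v = 0

/-- An `F`-valued `k`-plectic form: a smooth closed `(k+1)`-form, nondegenerate at each point. -/
structure IsPlectic [IsManifold I ∞ M] (w : DiffForm I (k + 1) F M) : Prop where
  smooth : SmoothOn I w univ
  nondegenerate : ∀ x, Nondegenerate (w x)
  closed : ∀ x, extDer I w x = 0

variable (k F)

/-- The canonical `F`-valued `k`-form on `X = ⋀ᵏ T^*M ⊗ F`:
`Θ_{(x, η)}(v₁, …, v_k) = η(π_* v₁, …, π_* v_k)`. -/
def canonicalTheta (M : Type*) [TopologicalSpace M] [ChartedSpace H M] [IsManifold I ∞ M] :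
    DiffForm (formModel I k F) k F (FormBundle I k F M) :=
  fun p ↦ p.2.compContinuousLinearMap
    (mfderiv (formModel I k F) I (TotalSpace.proj : FormBundle I k F M → M) p)

/-- The canonical `F`-valued `(k+1)`-form `Ω = dΘ` on `X = ⋀ᵏ T^*M ⊗ F`. -/
def canonicalOmega (M : Type*) [TopologicalSpace M] [ChartedSpace H M] [IsManifold I ∞ M] :
    DiffForm (formModel I k F) (k + 1) F (FormBundle I k F M) :=
  extDer (formModel I k F) (canonicalTheta I k F M)

end Multisymplectic

end

open Multisymplectic

/-! Closedness makes `w` locally exact, `w = dα`, and `α` is itself a local section of `X`. Since `π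
∘ α = id`, pulling `Θ` back along this section returns `α` (`pullback_section_canonicalTheta`); as
`d` commutes with pullback (`extDer_pullback`), `α^*Ω = d(α^*Θ) = dα = w`.

The primitive comes from the Poincaré lemma in a chart, using the homotopy operator `b(x) = ∫₀¹ t^k
ι_x w(tx) dt`. When `dw = 0`, Cartan's formula for the radial field turns the integrand of `db` into
the `t`-derivative of `t^(k+1) w(tx)`, so `db = w` (`apply_fderiv_radialHomotopy`). Because `extDer`
uses a different chart at each point, `extDer_pullback` is also what moves `d` in and out of a fixed
chart.

A section is a topological embedding because `π` is a left inverse. It is an immersion because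
fibrewise translation by `-α` is a diffeomorphism over `U` carrying it to the zero section, which
bundle charts read as `u ↦ (u, 0)` (`isSmoothEmbedding_section`). -/

/-! ### Smooth dependence of integrals on parameters. -/

section ParametricIntegral

open MeasureTheory

variable {E G : Type*} [NormedAddCommGroup E] [NormedSpace ℝ E]
  [NormedAddCommGroup G] [NormedSpace ℝ G]

/-- Differentiation under the integral sign for a jointly `C^1` integrand on a compact interval. -/
theorem hasFDerivAt_intervalIntegral_of_contDiff [FiniteDimensional ℝ E] {g : E × ℝ → G}
    (hg : ContDiff ℝ 1 g) (a b : ℝ) (x : E) :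
    HasFDerivAt (fun y ↦ ∫ t in a..b, g (y, t))
      (∫ t in a..b, (fderiv ℝ g (x, t)).comp (ContinuousLinearMap.inl ℝ E ℝ)) x := by
  have hcont : Continuous fun p : E × ℝ ↦
      (fderiv ℝ g p).comp (ContinuousLinearMap.inl ℝ E ℝ) :=
    (hg.continuous_fderiv one_ne_zero).clm_comp continuous_const
  -- Joint continuity on a compact product gives a constant dominating function.
  obtain ⟨C, hC⟩ := ((isCompact_closedBall x 1).prod
    (isCompact_uIcc (a := a) (b := b))).bddAbove_image hcont.norm.continuousOn
  refine intervalIntegral.hasFDerivAt_integral_of_dominated_of_fderiv_le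
    (F' := fun y t ↦ (fderiv ℝ g (y, t)).comp (ContinuousLinearMap.inl ℝ E ℝ))
    (bound := fun _ ↦ C) (Metric.ball_mem_nhds x one_pos) ?_ ?_ ?_ ?_ ?_ ?_
  · exact .of_forall fun y ↦
      (hg.continuous.comp (Continuous.prodMk_right y)).aestronglyMeasurable
  · exact (hg.continuous.comp (Continuous.prodMk_right x)).intervalIntegrable _ _
  · exact (hcont.comp (Continuous.prodMk_right x)).aestronglyMeasurable
  · refine .of_forall fun t ht y hy ↦ hC ⟨(y, t), ⟨Metric.ball_subset_closedBall hy, ?_⟩, rfl⟩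
    exact uIoc_subset_uIcc ht
  · exact intervalIntegrable_const
  · refine .of_forall fun t _ y _ ↦ ?_
    exact ((hg.differentiable one_ne_zero (y, t)).hasFDerivAt).comp y (hasFDerivAt_prodMk_left y t)

/-- The integral of a `C^n` function over a compact interval is `C^n` in the parameters. -/
theorem contDiff_intervalIntegral_nat [FiniteDimensional ℝ E] (n : ℕ) {g : E × ℝ → G}
    (hg : ContDiff ℝ n g) (a b : ℝ) :
    ContDiff ℝ n (fun y ↦ ∫ t in a..b, g (y, t)) := by
  induction n generalizing g with
  | zero =>
    rw [Nat.cast_zero, contDiff_zero] at hg ⊢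
    exact intervalIntegral.continuous_parametric_intervalIntegral_of_continuous'
      (f := fun y t ↦ g (y, t)) hg a b
  | succ n ih =>
    have hD := hasFDerivAt_intervalIntegral_of_contDiff
      (hg.of_le (by exact_mod_cast Nat.le_add_left 1 n)) a b
    have hg' : ContDiff ℝ n fun p ↦ (fderiv ℝ g p).comp (ContinuousLinearMap.inl ℝ E ℝ) :=
      (hg.fderiv_right (m := n) (by norm_cast)).clm_comp contDiff_const
    -- The induction keeps `G` fixed, so the derivative is tested on one vector `v` at a time; it is
    -- then again an integral with values in `G`.
    rw [Nat.cast_add, Nat.cast_one, contDiff_succ_iff_fderiv_apply]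
    refine ⟨fun x ↦ (hD x).differentiableAt, by simp, fun v ↦ ?_⟩
    have h : (fun x ↦ fderiv ℝ (fun y ↦ ∫ t in a..b, g (y, t)) x v) = fun x ↦ ∫ t in a..b,
        (fderiv ℝ g (x, t)).comp (ContinuousLinearMap.inl ℝ E ℝ) v := by
      funext x
      rw [(hD x).fderiv, ContinuousLinearMap.intervalIntegral_apply]
      exact (hg'.continuous.comp (Continuous.prodMk_right x)).intervalIntegrable _ _
    rw [h]
    exact ih (hg'.clm_apply contDiff_const)

/-- The integral of a smooth function over a compact interval depends smoothly on parameters. -/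
theorem contDiff_intervalIntegral [FiniteDimensional ℝ E] {g : E × ℝ → G}
    (hg : ContDiff ℝ ∞ g) (a b : ℝ) :
    ContDiff ℝ ∞ (fun y ↦ ∫ t in a..b, g (y, t)) :=
  contDiff_infty.2 fun n ↦ contDiff_intervalIntegral_nat n (contDiff_infty.1 hg n) a b

end ParametricIntegral

/-! ### The radial homotopy operator. -/

section Homotopy

open MeasureTheory

variable {E G K : Type*} [NormedAddCommGroup E] [NormedSpace ℝ E]
  [NormedAddCommGroup G] [NormedSpace ℝ G] [NormedAddCommGroup K] [NormedSpace ℝ K]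
  {w : E → G}

theorem contDiff_radialContraction (L : G →L[ℝ] E →L[ℝ] K) (hw : ContDiff ℝ ∞ w) (k : ℕ) :
    ContDiff ℝ ∞ fun p : E × ℝ ↦ p.2 ^ k • L (w (p.2 • p.1)) p.1 :=
  (contDiff_snd.pow k).smul
    ((L.contDiff.comp (hw.comp (contDiff_snd.smul contDiff_fst))).clm_apply contDiff_fst)

/-- Product rule in the space variable: one term from the contracted vector, one from `w (t • x)`,
where the chain rule supplies the extra factor `t`. -/
theorem fderiv_radialContraction_comp_inl (L : G →L[ℝ] E →L[ℝ] K) (hw : ContDiff ℝ ∞ w) (k : ℕ)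
    (x : E) (t : ℝ) :
    (fderiv ℝ (fun p : E × ℝ ↦ p.2 ^ k • L (w (p.2 • p.1)) p.1) (x, t)).comp
        (ContinuousLinearMap.inl ℝ E ℝ) =
      t ^ k • L (w (t • x)) + t ^ (k + 1) • (L.comp (fderiv ℝ w (t • x))).flip x := by
  have h1 : HasFDerivAt (fun y : E ↦ t • y) (t • ContinuousLinearMap.id ℝ E) x :=
    (hasFDerivAt_id x).const_smul t
  have hwd := (hw.differentiable (by simp) (t • x)).hasFDerivAt
  have h2 := L.hasFDerivAt.comp x (hwd.comp x h1)
  have h3 := (h2.clm_apply (hasFDerivAt_id x)).const_smul (t ^ k)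
  have h4 := HasFDerivAt.comp (f := fun y : E ↦ (y, t)) x
    ((contDiff_radialContraction L hw k).differentiable (by simp) (x, t)).hasFDerivAt
    (hasFDerivAt_prodMk_left x t)
  refine (h4.unique h3).trans ?_
  ext v
  simp [smul_smul, pow_succ]

/-- For a `(k+1)`-form, `t ^ (k + 1) • w (t • x)` is its pullback under scaling by `t`. The
derivative is grouped to match the two terms in `fderiv_radialContraction_comp_inl` after
alternatization. -/
theorem hasDerivAt_pow_smul_radial (hw : ContDiff ℝ ∞ w) (k : ℕ) (x : E) (t : ℝ) :
    HasDerivAt (fun t : ℝ ↦ t ^ (k + 1) • w (t • x))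
      (t ^ k • ((k + 1) • w (t • x)) + t ^ (k + 1) • fderiv ℝ w (t • x) x) t := by
  have h1 : HasDerivAt (fun t : ℝ ↦ t • x) x t := by
    simpa using (hasDerivAt_id t).smul_const x
  have h2 := (hw.differentiable (by simp) (t • x)).hasFDerivAt.comp_hasDerivAt t h1
  refine ((hasDerivAt_pow (k + 1) t).smul h2).congr_deriv ?_
  rw [add_comm, ← Nat.cast_smul_eq_nsmul ℝ, smul_smul, mul_comm]
  rfl

/-- Fundamental theorem of calculus; the exponent `k + 1` kills the endpoint `t = 0` even when `k =
0`. -/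
theorem integral_pow_smul_radial [CompleteSpace G] (hw : ContDiff ℝ ∞ w) (k : ℕ) (x : E) :
    ∫ t in (0 : ℝ)..1, (t ^ k • ((k + 1) • w (t • x)) + t ^ (k + 1) • fderiv ℝ w (t • x) x) =
      w x := by
  rw [intervalIntegral.integral_eq_sub_of_hasDerivAt
    fun t _ ↦ hasDerivAt_pow_smul_radial hw k x t]
  · simp
  · refine Continuous.intervalIntegrable ?_ _ _
    have h1 : Continuous fun t : ℝ ↦ t • x := continuous_id.smul continuous_const
    have h2 : Continuous fun t : ℝ ↦ w (t • x) := hw.continuous.comp h1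
    refine Continuous.add ?_ ?_
    · exact (continuous_pow k).smul (h2.const_smul (k + 1))
    · exact (continuous_pow (k + 1)).smul
        (((hw.continuous_fderiv (by simp)).comp h1).clm_apply continuous_const)

/-- The homotopy operator of the Poincaré lemma, for contraction `L` and radial weight `t ^ k`. -/
noncomputable def radialHomotopy (L : G →L[ℝ] E →L[ℝ] K) (k : ℕ) (w : E → G) (x : E) : K :=
  ∫ t in (0 : ℝ)..1, t ^ k • L (w (t • x)) x

theorem contDiff_radialHomotopy [FiniteDimensional ℝ E] (L : G →L[ℝ] E →L[ℝ] K)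
    (hw : ContDiff ℝ ∞ w) (k : ℕ) : ContDiff ℝ ∞ (radialHomotopy L k w) :=
  contDiff_intervalIntegral (contDiff_radialContraction L hw k) 0 1

/-- The algebraic core of the Poincaré lemma: `P` plays the role of alternatization, and the
two hypotheses together say that Cartan's formula holds for the radial vector field. -/
theorem apply_fderiv_radialHomotopy [FiniteDimensional ℝ E] [CompleteSpace G] [CompleteSpace K]
    (L : G →L[ℝ] E →L[ℝ] K) (P : (E →L[ℝ] K) →L[ℝ] G) (hw : ContDiff ℝ ∞ w) (k : ℕ) {x : E}
    (hL : ∀ g, P (L g) = (k + 1) • g)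
    (hx : ∀ t ∈ Icc (0 : ℝ) 1,
      P ((L.comp (fderiv ℝ w (t • x))).flip x) = fderiv ℝ w (t • x) x) :
    P (fderiv ℝ (radialHomotopy L k w) x) = w x := by
  set g : E × ℝ → K := fun p : E × ℝ ↦ p.2 ^ k • L (w (p.2 • p.1)) p.1 with hgdef
  have hg : ContDiff ℝ ∞ g := contDiff_radialContraction L hw k
  have hD : HasFDerivAt (radialHomotopy L k w) _ x :=
    hasFDerivAt_intervalIntegral_of_contDiff (hg.of_le (by exact_mod_cast le_top)) 0 1 x
  have hcont : Continuous fun t : ℝ ↦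
      (fderiv ℝ g (x, t)).comp (ContinuousLinearMap.inl ℝ E ℝ) :=
    ((hg.continuous_fderiv (by simp)).comp (Continuous.prodMk_right x)).clm_comp continuous_const
  have hint : IntervalIntegrable (fun t : ℝ ↦
      (fderiv ℝ g (x, t)).comp (ContinuousLinearMap.inl ℝ E ℝ)) volume 0 1 :=
    hcont.intervalIntegrable _ _
  -- With `P` moved under the integral and `w x` written as an integral, only integrands on `[0, 1]`
  -- need comparing, which is where `hx` applies.
  rw [hD.fderiv, ← ContinuousLinearMap.intervalIntegral_comp_comm P hint,
    ← integral_pow_smul_radial hw k x]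
  refine intervalIntegral.integral_congr fun t ht ↦ ?_
  rw [uIcc_of_le zero_le_one] at ht
  simp only [hgdef, fderiv_radialContraction_comp_inl L hw k x t, map_add, map_smul, hL, hx t ht]

end Homotopy

/-! ### The Poincaré lemma on a normed space. -/

section Poincare

open ContinuousAlternatingMap

variable {E F : Type*} [NormedAddCommGroup E] [NormedSpace ℝ E]
  [NormedAddCommGroup F] [NormedSpace ℝ F] {k : ℕ}

/-- If the alternatization of `A` vanishes, contracting `A` with `x` in its form argument and
alternatizing gives back the derivative `A x`. -/
theorem alternatizeUncurryFin_contract (A : E →L[ℝ] E [⋀^Fin (k + 1)]→L[ℝ] F)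
    (hA : alternatizeUncurryFin A = 0) (x : E) (B : E →L[ℝ] E [⋀^Fin k]→L[ℝ] F)
    (hB : ∀ v, B v = (A v).curryLeft x) :
    alternatizeUncurryFin B = A x := by
  ext v
  -- At `(x, v)` the zeroth summand is `A x v`; prefixing `x` shifts the other indices by one, so
  -- they are minus the summands for `B`.
  have h := congr($hA (Fin.cons x v))
  rw [alternatizeUncurryFin_apply, Fin.sum_univ_succ] at h
  simp only [Fin.val_zero, pow_zero, one_smul, Fin.cons_zero, Fin.removeNth_zero, Fin.tail_cons,
    Fin.val_succ, Fin.cons_succ, pow_succ, mul_neg_one, neg_smul, Finset.sum_neg_distrib] at h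
  rw [alternatizeUncurryFin_apply, eq_comm, ← sub_eq_zero, sub_eq_add_neg]
  refine Eq.trans ?_ h
  congr 2
  refine Finset.sum_congr rfl fun i _ ↦ ?_
  rw [hB, curryLeft_apply_apply]
  congr 2
  funext j
  cases j using Fin.cases with
  | zero => simp [Fin.removeNth]
  | succ j => simp [Fin.removeNth, Fin.succ_succAbove_succ]

/-- **Poincaré lemma**: a form that is closed on a set star-shaped about the origin has a smooth
primitive on that set. -/
theorem exists_contDiff_extDeriv_eq [FiniteDimensional ℝ E] [CompleteSpace F]
    {w : E → E [⋀^Fin (k + 1)]→L[ℝ] F} (hw : ContDiff ℝ ∞ w) {s : Set E} (hs : StarConvex ℝ 0 s)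
    (hws : ∀ x ∈ s, extDeriv w x = 0) :
    ∃ b : E → E [⋀^Fin k]→L[ℝ] F, ContDiff ℝ ∞ b ∧ ∀ x ∈ s, extDeriv b x = w x := by
  refine ⟨radialHomotopy (curryLeftLI (𝕜 := ℝ) (E := E) (F := F) (n := k)).toContinuousLinearMap
    k w, contDiff_radialHomotopy _ hw k, fun x hx ↦ ?_⟩
  -- Alternatization here is an unnormalised signed sum, so contracting and re-alternatizing
  -- multiplies by `k + 1`, as `hL` demands.
  refine apply_fderiv_radialHomotopy
    (curryLeftLI (𝕜 := ℝ) (E := E) (F := F) (n := k)).toContinuousLinearMap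
    (alternatizeUncurryFinCLM ℝ E F) hw k (fun g ↦ alternatizeUncurryFin_curryLeft g)
    fun t ht ↦ ?_
  exact alternatizeUncurryFin_contract (fderiv ℝ w (t • x)) (hws _ (hs.smul_mem hx ht.1 ht.2)) x _
    fun v ↦ rfl

/-- **Poincaré lemma**, local form: a closed form on a neighbourhood of a point has a smooth
primitive near that point. -/
theorem exists_ball_contDiff_extDeriv_eq [FiniteDimensional ℝ E] [CompleteSpace F]
    {w : E → E [⋀^Fin (k + 1)]→L[ℝ] F} {s : Set E} {c : E} (hs : s ∈ 𝓝 c)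
    (hw : ∀ x ∈ s, ContDiffAt ℝ ∞ w x) (hws : ∀ x ∈ s, extDeriv w x = 0) :
    ∃ r > 0, Metric.ball c r ⊆ s ∧ ∃ b : E → E [⋀^Fin k]→L[ℝ] F, ContDiff ℝ ∞ b ∧
      ∀ x ∈ Metric.ball c r, extDeriv b x = w x := by
  obtain ⟨R, hR, hRs⟩ := Metric.nhds_basis_closedBall.mem_iff.1 hs
  -- The cutoff makes `f • w` smooth everywhere while agreeing with `w` near each point of the half
  -- ball, hence also closed there.
  let f : ContDiffBump c := ⟨R / 2, R, by positivity, by linarith⟩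
  have hball : Metric.ball c (R / 2) ⊆ s :=
    (Metric.ball_subset_closedBall.trans (Metric.closedBall_subset_closedBall (by linarith))).trans
      hRs
  have hfw : ContDiff ℝ ∞ fun x ↦ f x • w x := by
    refine contDiff_iff_contDiffAt.2 fun x ↦ ?_
    by_cases hx : x ∈ Metric.closedBall c R
    · exact f.contDiff.contDiffAt.smul (hw x (hRs hx))
    · refine (contDiffAt_const (c := 0)).congr_of_eventuallyEq ?_
      filter_upwards [Metric.isClosed_closedBall.isOpen_compl.mem_nhds hx] with y hy
      have hy' : R ≤ dist y c := (not_le.1 fun h ↦ hy (Metric.mem_closedBall.2 h)).le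
      rw [f.zero_of_le_dist hy', zero_smul]
  have heq : ∀ x ∈ Metric.ball c (R / 2), (fun x ↦ f x • w x) =ᶠ[𝓝 x] w := fun x hx ↦ by
    filter_upwards [f.eventuallyEq_one_of_mem_ball hx] with y hy
    rw [hy, Pi.one_apply, one_smul]
  have hshift {j : ℕ} (v : E → E [⋀^Fin j]→L[ℝ] F) (a x : E) :
      extDeriv (fun y ↦ v (y + a)) x = extDeriv v (x + a) := by
    rw [extDeriv, extDeriv, fderiv_comp_add_right]
  -- The centre is translated to the origin, about which star-shapedness is required.
  obtain ⟨b, hb, hbw⟩ := exists_contDiff_extDeriv_eq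
    (w := fun x ↦ f (x + c) • w (x + c)) (hfw.comp (contDiff_id.add contDiff_const))
    (s := Metric.ball 0 (R / 2)) ((convex_ball 0 _).starConvex (by simpa using hR)) fun x hx ↦ by
      have hx' : x + c ∈ Metric.ball c (R / 2) := by simpa using hx
      rw [hshift (fun x ↦ f x • w x) c x, (heq _ hx').extDeriv_eq, hws _ (hball hx')]
  refine ⟨R / 2, by positivity, hball, fun x ↦ b (x + -c),
    hb.comp (contDiff_id.add contDiff_const), fun x hx ↦ ?_⟩
  rw [hshift, hbw _ (by simpa [← sub_eq_add_neg, dist_eq_norm] using hx), neg_add_cancel_right]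
  exact (heq x hx).eq_of_nhds

end Poincare

/-! ### Naturality of the exterior derivative on manifolds. -/

namespace Multisymplectic

variable {E : Type*} [NormedAddCommGroup E] [NormedSpace ℝ E] {H : Type*} [TopologicalSpace H]
  {I : ModelWithCorners ℝ E H} {M : Type*} [TopologicalSpace M] [ChartedSpace H M]
  {E' : Type*} [NormedAddCommGroup E'] [NormedSpace ℝ E'] {H' : Type*} [TopologicalSpace H']
  {I' : ModelWithCorners ℝ E' H'} {M' : Type*} [TopologicalSpace M'] [ChartedSpace H' M']
  {k : ℕ} {F : Type*} [NormedAddCommGroup F] [NormedSpace ℝ F]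

/-- The exterior derivative is local. -/
theorem extDer_congr [I.Boundaryless] {w w' : DiffForm I k F M} {x : M}
    (h : ∀ᶠ y in 𝓝 x, w y = w' y) : extDer I w x = extDer I w' x := by
  have hc : Filter.Tendsto (extChartAt I x).symm (𝓝 (extChartAt I x x)) (𝓝 x) := by
    simpa using (continuousAt_extChartAt_symm (I := I) x).tendsto
  have h' : inChart I w x =ᶠ[𝓝 (extChartAt I x x)] inChart I w' x := by
    filter_upwards [hc.eventually h] with u hu
    simp only [inChart, hu]
  simp only [extDer, h'.extDerivWithin_eq_nhds]

/-- In the preferred chart at the point itself, the exterior derivative needs no pullback. -/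
theorem extDer_apply [I.Boundaryless] [IsManifold I ∞ M] (w : DiffForm I k F M) (x : M) :
    extDer I w x = extDeriv (inChart I w x) (extChartAt I x x) := by
  rw [extDer, mfderiv_extChartAt_self, I.range_eq_univ, extDerivWithin_univ]
  rfl

/-- The chain rule for a map read in charts. -/
theorem mfderivWithin_extChartAt_symm_comp_fderiv [I.Boundaryless] [IsManifold I ∞ M]
    [IsManifold I' ∞ M'] {f : M → M'} {x : M} {x' : M'} {u : E} (hu : u ∈ (extChartAt I x).target)
    (hf : MDifferentiableAt I I' f ((extChartAt I x).symm u))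
    (hfu : f ((extChartAt I x).symm u) ∈ (extChartAt I' x').source) :
    (mfderivWithin 𝓘(ℝ, E') I' (extChartAt I' x').symm (range I')
        (extChartAt I' x' (f ((extChartAt I x).symm u))) : E' →L[ℝ] E').comp
        (fderiv ℝ (E := E) (F := E') (extChartAt I' x' ∘ f ∘ (extChartAt I x).symm) u) =
      (mfderiv I I' f ((extChartAt I x).symm u) : E →L[ℝ] E').comp
        (mfderivWithin 𝓘(ℝ, E) I (extChartAt I x).symm (range I) u : E →L[ℝ] E) := by
  have h1 := mdifferentiableWithinAt_extChartAt_symm hu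
  rw [I.range_eq_univ] at h1 ⊢
  rw [mfderivWithin_univ]
  have h2 : HasMFDerivAt 𝓘(ℝ, E) 𝓘(ℝ, E') (extChartAt I' x' ∘ f ∘ (extChartAt I x).symm) u _ :=
    (mdifferentiableAt_extChartAt (by rwa [extChartAt_source] at hfu)).hasMFDerivAt.comp u
      (hf.hasMFDerivAt.comp u (mdifferentiableWithinAt_univ.1 h1).hasMFDerivAt)
  have h3 := mfderivWithin_extChartAt_symm_comp_mfderiv_extChartAt' hfu
  have h4 := h2.mfderiv
  rw [mfderiv_eq_fderiv] at h4
  ext v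
  exact (congrArg (mfderivWithin 𝓘(ℝ, E') I' (extChartAt I' x').symm (range I')
    (extChartAt I' x' (f ((extChartAt I x).symm u)))) congr($h4 v)).trans congr($h3 _)

/-- The exterior derivative commutes with pullback under smooth maps. -/
theorem extDer_pullback [I.Boundaryless] [I'.Boundaryless] [IsManifold I ∞ M] [IsManifold I' ∞ M']
    {f : M → M'} {x : M} (hf : ContMDiffAt I I' 2 f x) {w : DiffForm I' k F M'}
    (hw : DifferentiableAt ℝ (inChart I' w (f x)) (extChartAt I' (f x) (f x))) :
    extDer I (pullback I I' f w) x =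
      (extDer I' w (f x)).compContinuousLinearMap (mfderiv I I' f x) := by
  set g : E → E' := extChartAt I' (f x) ∘ f ∘ (extChartAt I x).symm with hg
  have hgx : g (extChartAt I x x) = extChartAt I' (f x) (f x) := by simp [hg]
  have hgs : ContDiffAt ℝ 2 g (extChartAt I x x) := by
    have := (contMDiffAt_iff.1 hf).2
    rwa [I.range_eq_univ, contDiffWithinAt_univ] at this
  have hmd : ∀ᶠ y in 𝓝 x, MDifferentiableAt I I' f y := by
    filter_upwards [(contMDiffAt_iff_contMDiffAt_nhds (by decide)).1 hf] with y hy
      using hy.mdifferentiableAt (by decide)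
  have hsrc : ∀ᶠ y in 𝓝 x, f y ∈ (extChartAt I' (f x)).source :=
    hf.continuousAt.eventually (extChartAt_source_mem_nhds (f x))
  have hc : Filter.Tendsto (extChartAt I x).symm (𝓝 (extChartAt I x x)) (𝓝 x) := by
    simpa using (continuousAt_extChartAt_symm (I := I) x).tendsto
  -- In fixed charts the pullback under `f` is the Euclidean pullback under its coordinate
  -- expression `g`, reducing the claim to `extDeriv_pullback`.
  have key : inChart I (pullback I I' f w) x =ᶠ[𝓝 (extChartAt I x x)] fun u ↦
      (inChart I' w (f x) (g u)).compContinuousLinearMap (fderiv ℝ g u) := by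
    filter_upwards [hc.eventually hmd, hc.eventually hsrc, extChartAt_target_mem_nhds x]
      with u hmu hsu hu
    have hD := mfderivWithin_extChartAt_symm_comp_fderiv hu hmu hsu
    have hy : (extChartAt I' (f x)).symm (g u) = f ((extChartAt I x).symm u) :=
      (extChartAt I' (f x)).left_inv hsu
    -- All fibres are definitionally the same model space; forgetting the dependence on the point
    -- lets `congrArg` transport along `hy`.
    let W : M' → E' [⋀^Fin k]→L[ℝ] F := w
    have hW : W ((extChartAt I' (f x)).symm (g u)) = W (f ((extChartAt I x).symm u)) :=
      congrArg W hy
    ext v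
    change W (f ((extChartAt I x).symm u)) _ = W ((extChartAt I' (f x)).symm (g u)) _
    rw [hW]
    congr 1
    funext i
    exact congr($hD (v i)).symm
  have hD : HasMFDerivAt I I' f x (fderiv ℝ g (extChartAt I x x)) :=
    ⟨hf.continuousAt, (hgs.differentiableAt (by decide)).hasFDerivAt.hasFDerivWithinAt⟩
  rw [extDer_apply, extDer_apply, key.extDeriv_eq, extDeriv_pullback (hgx ▸ hw) hgs (by simp),
    hD.mfderiv,    hgx]
  rfl

theorem inChart_model (w : DiffForm 𝓘(ℝ, E) k F E) (u : E) :
    inChart 𝓘(ℝ, E) w u = (w : E → E [⋀^Fin k]→L[ℝ] F) := by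
  funext y
  ext v
  have h : mfderivWithin 𝓘(ℝ, E) 𝓘(ℝ, E) (extChartAt 𝓘(ℝ, E) u).symm (range 𝓘(ℝ, E)) y =
      ContinuousLinearMap.id ℝ E := by
    rw [extChartAt_model_space_eq_id, ModelWithCorners.range_eq_univ, mfderivWithin_univ]
    exact mfderiv_id
  simp only [inChart, h]
  rfl

/-- On a normed space the exterior derivative is the usual one. -/
theorem extDer_model (w : DiffForm 𝓘(ℝ, E) k F E) (u : E) :
    extDer 𝓘(ℝ, E) w u = extDeriv (E := E) w u := by
  refine (extDer_apply w u).trans ?_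
  rw [inChart_model]
  rfl

end Multisymplectic

/-! ### The bundle of forms and `Θ` in charts. -/

namespace Multisymplectic

variable {E : Type*} [NormedAddCommGroup E] [NormedSpace ℝ E] {H : Type*} [TopologicalSpace H]
  {I : ModelWithCorners ℝ E H} {M : Type*} [TopologicalSpace M] [ChartedSpace H M]
  {k : ℕ} {F : Type*} [NormedAddCommGroup F] [NormedSpace ℝ F] [IsManifold I ∞ M]

theorem baseSet_trivializationAt (x₀ : M) :
    (trivializationAt (E [⋀^Fin k]→L[ℝ] F) (FormSpace I k F : M → Type _) x₀).baseSet =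
      (chartAt H x₀).source :=
  rfl

/-- The preferred trivializations of the bundle of forms are pullbacks under inverse charts. -/
theorem trivializationAt_apply_snd {x₀ y : M} (hy : y ∈ (chartAt H x₀).source)
    (ζ : FormSpace I k F y) :
    (trivializationAt (E [⋀^Fin k]→L[ℝ] F) (FormSpace I k F : M → Type _) x₀ ⟨y, ζ⟩).2 =
      ζ.compContinuousLinearMap
        (mfderivWithin 𝓘(ℝ, E) I (extChartAt I x₀).symm (range I) (extChartAt I x₀ y)) := by
  -- The form bundle's cocycle is pullback by that of `TM`, so the claim reduces to tangent vectors: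
  -- the inverse trivialization of `TM` is the derivative of the inverse chart.
  have h := (TangentBundle.symmL_trivializationAt_eq_core (I := I) hy).symm.trans
    (TangentBundle.symmL_trivializationAt hy)
  ext v
  change ζ _ = ζ _
  congr 1
  funext i
  exact congr($h (v i))

theorem trivializationAt_section_snd (w : DiffForm I k F M) {x₀ y : M}
    (hy : y ∈ (chartAt H x₀).source) :
    (trivializationAt (E [⋀^Fin k]→L[ℝ] F) (FormSpace I k F : M → Type _) x₀ ⟨y, w y⟩).2 =
      inChart I w x₀ (extChartAt I x₀ y) := by
  rw [trivializationAt_apply_snd hy]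
  let W : M → E [⋀^Fin k]→L[ℝ] F := w
  have hW : W ((extChartAt I x₀).symm (extChartAt I x₀ y)) = W y :=
    congrArg W ((extChartAt I x₀).left_inv (by rwa [extChartAt_source]))
  ext v
  exact congr($hW _).symm

/-- Smoothness of a form at a point can be read off from its expression in any preferred chart. -/
theorem contMDiffAt_section_iff_inChart [I.Boundaryless] {w : DiffForm I k F M} {x₀ y : M}
    (hy : y ∈ (chartAt H x₀).source) :
    ContMDiffAt I (formModel I k F) ∞ (fun x ↦ (⟨x, w x⟩ : FormBundle I k F M)) y ↔
      ContDiffAt ℝ ∞ (inChart I w x₀) (extChartAt I x₀ y) := by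
  have hy' : y ∈ (extChartAt I x₀).source := by rwa [extChartAt_source]
  have hφy : (extChartAt I x₀).symm (extChartAt I x₀ y) = y := (extChartAt I x₀).left_inv hy'
  refine ((trivializationAt (E [⋀^Fin k]→L[ℝ] F) (FormSpace I k F : M → Type _)
    x₀).contMDiffAt_section_iff hy).trans ?_
  have heq : (fun x ↦ (trivializationAt (E [⋀^Fin k]→L[ℝ] F) (FormSpace I k F : M → Type _)
      x₀ ⟨x, w x⟩).2) =ᶠ[𝓝 y] inChart I w x₀ ∘ extChartAt I x₀ := by
    filter_upwards [(chartAt H x₀).open_source.mem_nhds hy] with x hx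
      using trivializationAt_section_snd w hx
  rw [heq.contMDiffAt_iff, ← contMDiffAt_iff_contDiffAt]
  refine ⟨fun h ↦ ?_, fun h ↦ h.comp y (contMDiffAt_extChartAt' hy)⟩
  have hsymm : ContMDiffAt 𝓘(ℝ, E) I ∞ (extChartAt I x₀).symm (extChartAt I x₀ y) :=
    (contMDiffOn_extChartAt_symm x₀).contMDiffAt
      (extChartAt_target_mem_nhds' ((extChartAt I x₀).map_source hy'))
  rw [← hφy] at h
  refine (h.comp (extChartAt I x₀ y) hsymm).congr_of_eventuallyEq ?_
  filter_upwards [extChartAt_target_mem_nhds' ((extChartAt I x₀).map_source hy')] with u hu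
  simp only [Function.comp_apply, (extChartAt I x₀).right_inv hu]

/-- In the preferred charts the canonical form is `(u, ξ) ↦ ξ ∘ fst`. -/
theorem inChart_canonicalTheta [I.Boundaryless] (p : FormBundle I k F M) {u : E}
    (hu : u ∈ (extChartAt I p.proj).target) (ξ : E [⋀^Fin k]→L[ℝ] F) :
    inChart (formModel I k F) (canonicalTheta I k F M) p (u, ξ) =
      ξ.compContinuousLinearMap (ContinuousLinearMap.fst ℝ E (E [⋀^Fin k]→L[ℝ] F)) := by
  set χ := extChartAt (formModel I k F) p with hχ
  set e := trivializationAt (E [⋀^Fin k]→L[ℝ] F) (FormSpace I k F : M → Type _) p.proj with he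
  have hus : (extChartAt I p.proj).symm u ∈ (chartAt H p.proj).source := by
    simpa only [extChartAt_source] using (extChartAt I p.proj).map_target hu
  have hbase {u' : E} (hu' : u' ∈ (extChartAt I p.proj).target) :
      (extChartAt I p.proj).symm u' ∈ e.baseSet := by
    rw [he, baseSet_trivializationAt, ← extChartAt_source I]
    exact (extChartAt I p.proj).map_target hu'
  have hχe (z : E × (E [⋀^Fin k]→L[ℝ] F)) :
      χ.symm z = e.toOpenPartialHomeomorph.symm ((extChartAt I p.proj).symm z.1, z.2) := by
    rw [hχ, FiberBundle.extChartAt]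
    rfl
  have htar : (u, ξ) ∈ χ.target := by
    rw [hχ, FiberBundle.extChartAt_target]
    exact ⟨⟨hu, hbase hu⟩, mem_univ _⟩
  have hproj {z : E × (E [⋀^Fin k]→L[ℝ] F)} (hz : z.1 ∈ (extChartAt I p.proj).target) :
      (χ.symm z).proj = (extChartAt I p.proj).symm z.1 := by
    rw [hχe]
    exact e.proj_symm_apply (e.mem_target.2 (hbase hz))
  have heq : (e (χ.symm (u, ξ))).2 = ξ := by
    rw [hχe, e.apply_symm_apply (e.mem_target.2 (hbase hu))]
  -- Obtained by differentiating `π ∘ χ⁻¹ = φ⁻¹ ∘ fst`, valid near `(u, ξ)`.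
  have hD : ((mfderiv (formModel I k F) I (TotalSpace.proj : FormBundle I k F M → M)
      (χ.symm (u, ξ))).comp (mfderivWithin 𝓘(ℝ, E × (E [⋀^Fin k]→L[ℝ] F)) (formModel I k F) χ.symm
        (range (formModel I k F)) (u, ξ)) : E × (E [⋀^Fin k]→L[ℝ] F) →L[ℝ] E) =
      (mfderivWithin 𝓘(ℝ, E) I (extChartAt I p.proj).symm (range I) u : E →L[ℝ] E).comp
        (ContinuousLinearMap.fst ℝ E (E [⋀^Fin k]→L[ℝ] F)) := by
    have h1 := mdifferentiableWithinAt_extChartAt_symm htar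
    have h2 := mdifferentiableWithinAt_extChartAt_symm hu
    rw [ModelWithCorners.range_eq_univ, mdifferentiableWithinAt_univ] at h1 h2
    rw [ModelWithCorners.range_eq_univ, ModelWithCorners.range_eq_univ, mfderivWithin_univ,
      mfderivWithin_univ]
    have h3 : MDifferentiableAt (formModel I k F) I (TotalSpace.proj : FormBundle I k F M → M)
        (χ.symm (u, ξ)) :=
      (contMDiffAt_proj (n := ∞) (FormSpace I k F : M → Type _)).mdifferentiableAt (by simp)
    have h4 := h3.hasMFDerivAt.comp (u, ξ) h1.hasMFDerivAt
    have h5 := HasMFDerivAt.comp (u, ξ) (f := Prod.fst) h2.hasMFDerivAt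
      (hasFDerivAt_fst (𝕜 := ℝ) (E := E) (F := E [⋀^Fin k]→L[ℝ] F) (p := (u, ξ))).hasMFDerivAt
    have h6 : TotalSpace.proj ∘ χ.symm =ᶠ[𝓝 (u, ξ)] (extChartAt I p.proj).symm ∘ Prod.fst := by
      filter_upwards [continuousAt_fst.eventually (extChartAt_target_mem_nhds' hu)] with z hz
        using hproj hz
    have h7 := hasMFDerivAt_unique h4 (h5.congr_of_eventuallyEq h6)
    exact h7
  have hφ : extChartAt I p.proj (χ.symm (u, ξ)).proj = u := by
    rw [hproj hu, (extChartAt I p.proj).right_inv hu]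
  have hξ := trivializationAt_apply_snd (x₀ := p.proj) (y := (χ.symm (u, ξ)).proj)
    (by rw [hproj hu]; exact hus) (χ.symm (u, ξ)).2
  let η : E [⋀^Fin k]→L[ℝ] F := (χ.symm (u, ξ)).2
  let D : E → E →L[ℝ] E := mfderivWithin 𝓘(ℝ, E) I (extChartAt I p.proj).symm (range I)
  -- The fibre coordinate `ξ` already contains the derivative of `φ⁻¹`, so it absorbs that factor of
  -- `hD` and only `fst` remains.
  have hη : ξ = η.compContinuousLinearMap (D u) :=
    (heq.symm.trans hξ).trans (congrArg (fun z ↦ η.compContinuousLinearMap (D z)) hφ)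
  ext v
  refine Eq.trans ?_ congr($hη (fun i ↦ (v i).1)).symm
  change η _ = η _
  congr 1
  funext i
  exact congr($hD (v i))

/-- In bundle coordinates `Θ` is linear in the fibre coordinate and independent of the base
coordinate. This regularity lets `extDer_pullback` apply to `Θ`. -/
theorem contDiffAt_inChart_canonicalTheta [I.Boundaryless] (p : FormBundle I k F M) :
    ContDiffAt ℝ ∞ (inChart (formModel I k F) (canonicalTheta I k F M) p)
      (extChartAt (formModel I k F) p p) := by
  have h : inChart (formModel I k F) (canonicalTheta I k F M) p
      =ᶠ[𝓝 (extChartAt (formModel I k F) p p)] fun z ↦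
      ContinuousAlternatingMap.compContinuousLinearMapCLM
        (ContinuousLinearMap.fst ℝ E (E [⋀^Fin k]→L[ℝ] F)) z.2 := by
    have hp : (extChartAt (formModel I k F) p p).1 = extChartAt I p.proj p.proj := by
      rw [FiberBundle.extChartAt]
      rfl
    have ht : (extChartAt I p.proj).target ∈ 𝓝 (extChartAt (formModel I k F) p p).1 := by
      rw [hp]
      exact extChartAt_target_mem_nhds p.proj
    filter_upwards [continuousAt_fst.eventually ht] with z hz
      using inChart_canonicalTheta p hz z.2
  refine ContDiffAt.congr_of_eventuallyEq ?_ h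
  exact (ContinuousLinearMap.contDiff _).contDiffAt.comp _ contDiffAt_snd

end Multisymplectic

/-! ### Sections of vector bundles are embeddings. -/

namespace Bundle

section Translate

variable {B : Type*} {V : B → Type*} [∀ x, AddCommGroup (V x)]

/-- Fibrewise translation of a vector bundle by a section. -/
def translate (F : Type*) (s : ∀ x, V x) (q : TotalSpace F V) : TotalSpace F V :=
  ⟨q.proj, q.2 + s q.proj⟩

theorem translate_neg_section (F : Type*) (s : ∀ x, V x) (x : B) :
    translate F (-s) ⟨x, s x⟩ = zeroSection F V x :=
  congrArg (TotalSpace.mk x) (add_neg_cancel (s x))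

end Translate

section SectionEmbedding

variable {𝕜 : Type*} [NontriviallyNormedField 𝕜]
  {EB : Type*} [NormedAddCommGroup EB] [NormedSpace 𝕜 EB] {HB : Type*} [TopologicalSpace HB]
  {IB : ModelWithCorners 𝕜 EB HB} {B : Type*} [TopologicalSpace B] [ChartedSpace HB B]
  {F : Type*} [NormedAddCommGroup F] [NormedSpace 𝕜 F]
  {V : B → Type*} [∀ x, AddCommGroup (V x)] [∀ x, Module 𝕜 (V x)] [∀ x, TopologicalSpace (V x)]
  [TopologicalSpace (TotalSpace F V)] [FiberBundle F V] [VectorBundle 𝕜 F V]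
  {n : ℕ∞ω} [ContMDiffVectorBundle n F V IB]

/-- Trivializations are fibrewise linear, so in one of them translation just adds the smooth
coordinate of `s`. -/
theorem contMDiffOn_translate {s : ∀ x, V x} {U : Set B} (hU : IsOpen U)
    (hs : ContMDiffOn IB (IB.prod 𝓘(𝕜, F)) n (fun x ↦ TotalSpace.mk' F x (s x)) U) :
    ContMDiffOn (IB.prod 𝓘(𝕜, F)) (IB.prod 𝓘(𝕜, F)) n (translate F s)
      (TotalSpace.proj ⁻¹' U) := by
  intro q hq
  refine ContMDiffAt.contMDiffWithinAt ?_
  set e := trivializationAt F V q.proj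
  have hqe : q.proj ∈ e.baseSet := mem_baseSet_trivializationAt F V q.proj
  have hproj : ContMDiffAt (IB.prod 𝓘(𝕜, F)) IB n (TotalSpace.proj : TotalSpace F V → B) q :=
    contMDiffAt_proj V
  rw [e.contMDiffAt_iff (e.mem_source.2 hqe)]
  refine ⟨hproj, ?_⟩
  have h1 : ContMDiffAt (IB.prod 𝓘(𝕜, F)) 𝓘(𝕜, F) n (fun p : TotalSpace F V ↦ (e p).2) q :=
    ((e.contMDiffAt_iff (e.mem_source.2 hqe)).1 contMDiffAt_id).2
  have h2 : ContMDiffAt IB 𝓘(𝕜, F) n (fun x ↦ (e ⟨x, s x⟩).2) q.proj :=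
    (e.contMDiffAt_section_iff hqe).1 ((hs _ hq).contMDiffAt (hU.mem_nhds hq))
  refine (h1.add (h2.comp q hproj)).congr_of_eventuallyEq ?_
  filter_upwards [hproj.continuousAt.preimage_mem_nhds (e.open_baseSet.mem_nhds hqe)] with p hp
  exact (e.linear 𝕜 hp).map_add p.2 (s p.proj)

/-- Translation by a section that is `C^n` on an open set, as a homeomorphism over that set. -/
noncomputable def translateHomeomorph {s : ∀ x, V x} {U : Set B} (hU : IsOpen U)
    (hs : ContMDiffOn IB (IB.prod 𝓘(𝕜, F)) n (fun x ↦ TotalSpace.mk' F x (s x)) U) :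
    OpenPartialHomeomorph (TotalSpace F V) (TotalSpace F V) where
  toFun := translate F (-s)
  invFun := translate F s
  source := TotalSpace.proj ⁻¹' U
  target := TotalSpace.proj ⁻¹' U
  map_source' _ h := h
  map_target' _ h := h
  left_inv' q _ := congrArg (TotalSpace.mk q.proj) (neg_add_cancel_right _ _)
  right_inv' q _ := congrArg (TotalSpace.mk q.proj) (add_neg_cancel_right _ _)
  open_source := hU.preimage (FiberBundle.continuous_proj F V)
  open_target := hU.preimage (FiberBundle.continuous_proj F V)
  continuousOn_toFun := (contMDiffOn_translate hU hs.neg_section).continuousOn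
  continuousOn_invFun := (contMDiffOn_translate hU hs).continuousOn

variable [IsManifold IB n B]

/-- These charts straighten the section into the zero section; they are compatible because
translation is `C^n` in both directions. -/
theorem translateHomeomorph_trans_chartAt_mem_maximalAtlas {s : ∀ x, V x} {U : Set B}
    (hU : IsOpen U)
    (hs : ContMDiffOn IB (IB.prod 𝓘(𝕜, F)) n (fun x ↦ TotalSpace.mk' F x (s x)) U)
    (p : TotalSpace F V) :
    translateHomeomorph hU hs ≫ₕ chartAt (ModelProd HB F) p ∈
      IsManifold.maximalAtlas (IB.prod 𝓘(𝕜, F)) n (TotalSpace F V) := by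
  refine OpenPartialHomeomorph.mem_maximalAtlas_of_contMDiffOn _ ?_ ?_
  · have h : ContMDiffOn (IB.prod 𝓘(𝕜, F)) (IB.prod 𝓘(𝕜, F)) n (chartAt (ModelProd HB F) p)
        (chartAt (ModelProd HB F) p).source := contMDiffOn_chart
    have h' : ContMDiffOn (IB.prod 𝓘(𝕜, F)) (IB.prod 𝓘(𝕜, F)) n (translateHomeomorph hU hs)
        (TotalSpace.proj ⁻¹' U) := contMDiffOn_translate hU hs.neg_section
    exact h.comp' h'
  · have h : ContMDiffOn (IB.prod 𝓘(𝕜, F)) (IB.prod 𝓘(𝕜, F)) n (chartAt (ModelProd HB F) p).symm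
        (chartAt (ModelProd HB F) p).target := contMDiffOn_chart_symm
    have h' : ContMDiffOn (IB.prod 𝓘(𝕜, F)) (IB.prod 𝓘(𝕜, F)) n (translateHomeomorph hU hs).symm
        (TotalSpace.proj ⁻¹' U) := contMDiffOn_translate hU hs
    exact h'.comp' h

/-- A `C^n` local section of a vector bundle is an immersion. -/
theorem isImmersionAtOfComplement_section {s : ∀ x, V x} {U : TopologicalSpace.Opens B}
    (hs : ContMDiffOn IB (IB.prod 𝓘(𝕜, F)) n (fun x ↦ TotalSpace.mk' F x (s x)) U) (x : U) :
    IsImmersionAtOfComplement F IB (IB.prod 𝓘(𝕜, F)) n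
      (fun y : U ↦ TotalSpace.mk' F (y : B) (s y)) x := by
  set e := trivializationAt F V (x : B) with he
  have hb : IsOpen ((Subtype.val : U → B) ⁻¹' e.baseSet) :=
    e.open_baseSet.preimage continuous_subtype_val
  have hcont : Continuous fun y : U ↦ TotalSpace.mk' F (y : B) (s y) :=
    continuousOn_iff_continuous_domRestrict.1 hs.continuousOn
  -- The source chart is cut down to the base set of `e`, where linearity of `e` makes the zero
  -- section read `(u, 0)`.
  refine IsImmersionAtOfComplement.mk_of_continuousAt hcont.continuousAt
    (ContinuousLinearEquiv.refl 𝕜 (EB × F))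
    ((chartAt HB x).restr ((Subtype.val : U → B) ⁻¹' e.baseSet))
    (translateHomeomorph U.isOpen hs ≫ₕ chartAt (ModelProd HB F) (zeroSection F V x)) ?_ ?_
    (restr_mem_maximalAtlas _ (IsManifold.chart_mem_maximalAtlas x) hb)
    (translateHomeomorph_trans_chartAt_mem_maximalAtlas U.isOpen hs _) ?_
  · rw [OpenPartialHomeomorph.restr_source' _ _ hb]
    exact ⟨mem_chart_source HB x, mem_baseSet_trivializationAt F V (x : B)⟩
  · refine ⟨x.2, ?_⟩
    change translate F (-s) ⟨x, s x⟩ ∈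
      (chartAt (ModelProd HB F) (zeroSection F V (x : B))).source
    rw [translate_neg_section]
    exact mem_chart_source _ _
  · intro u hu
    set D := (chartAt HB x).restr ((Subtype.val : U → B) ⁻¹' e.baseSet) with hD
    set y : U := (D.extend IB).symm u with hy
    have hyD : y ∈ D.source := by
      have := (D.extend IB).map_target hu
      rwa [D.extend_source] at this
    rw [hD, OpenPartialHomeomorph.restr_source' _ _ hb] at hyD
    have hyu : extChartAt IB (x : B) (y : B) = u := (D.extend IB).right_inv hu
    change extChartAt (IB.prod 𝓘(𝕜, F)) (zeroSection F V x) (translate F (-s) ⟨y, s y⟩) = (u, 0)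
    rw [translate_neg_section, FiberBundle.extChartAt]
    change (extChartAt IB (x : B) (e (zeroSection F V y)).1, (e (zeroSection F V y)).2) = (u, 0)
    rw [e.zeroSection 𝕜 hyD.2, hyu]

/-- A `C^n` local section of a vector bundle is a `C^n` embedding. -/
theorem isSmoothEmbedding_section {s : ∀ x, V x} {U : TopologicalSpace.Opens B}
    (hs : ContMDiffOn IB (IB.prod 𝓘(𝕜, F)) n (fun x ↦ TotalSpace.mk' F x (s x)) U) :
    IsSmoothEmbedding IB (IB.prod 𝓘(𝕜, F)) n (fun y : U ↦ TotalSpace.mk' F (y : B) (s y)) where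
  isImmersion := IsImmersionOfComplement.isImmersion fun x ↦ isImmersionAtOfComplement_section hs x
  isEmbedding := .of_comp (continuousOn_iff_continuous_domRestrict.1 hs.continuousOn)
    (FiberBundle.continuous_proj F V) (by exact Topology.IsEmbedding.subtypeVal)

end SectionEmbedding

end Bundle

/-! ### Local primitives, and `Ω` pulled back along sections. -/

namespace Multisymplectic

variable {E : Type*} [NormedAddCommGroup E] [NormedSpace ℝ E] {H : Type*} [TopologicalSpace H]
  {I : ModelWithCorners ℝ E H} {M : Type*} [TopologicalSpace M] [ChartedSpace H M]
  {k : ℕ} {F : Type*} [NormedAddCommGroup F] [NormedSpace ℝ F] [IsManifold I ∞ M]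

theorem SmoothOn.contDiffAt_inChart [I.Boundaryless] {w : DiffForm I k F M} {s : Set M}
    (hw : SmoothOn I w s) (hs : IsOpen s) {x₀ y : M} (hy : y ∈ (chartAt H x₀).source)
    (hys : y ∈ s) : ContDiffAt ℝ ∞ (inChart I w x₀) (extChartAt I x₀ y) :=
  (contMDiffAt_section_iff_inChart hy).1 ((hw y hys).contMDiffAt (hs.mem_nhds hys))

/-- The expression in a chart of the pullback under that chart. -/
theorem inChart_pullback_extChartAt (b : E → E [⋀^Fin k]→L[ℝ] F) {x₀ : M} {u : E}
    (hu : u ∈ (extChartAt I x₀).target) :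
    inChart I (pullback I 𝓘(ℝ, E) (extChartAt I x₀) b) x₀ u = b u := by
  have h := mfderiv_extChartAt_comp_mfderivWithin_extChartAt_symm hu
  have hb : b (extChartAt I x₀ ((extChartAt I x₀).symm u)) = b u :=
    congrArg b ((extChartAt I x₀).right_inv hu)
  ext v
  refine Eq.trans ?_ congr($hb v)
  change b _ _ = b _ _
  congr 1
  funext i
  exact congr($h (v i))

/-- Pulling the expression of a form in a chart back under that chart recovers the form. -/
theorem compContinuousLinearMap_inChart (w : DiffForm I k F M) {x₀ y : M}
    (hy : y ∈ (extChartAt I x₀).source) :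
    (inChart I w x₀ (extChartAt I x₀ y)).compContinuousLinearMap
      (mfderiv I 𝓘(ℝ, E) (extChartAt I x₀) y) = w y := by
  have h := mfderivWithin_extChartAt_symm_comp_mfderiv_extChartAt' hy
  let W : M → E [⋀^Fin k]→L[ℝ] F := w
  have hW : W ((extChartAt I x₀).symm (extChartAt I x₀ y)) = W y :=
    congrArg W ((extChartAt I x₀).left_inv hy)
  ext v
  refine Eq.trans ?_ congr($hW v)
  change W _ _ = W _ _
  congr 1
  funext i
  exact congr($h (v i))

/-- A smooth closed form is closed in every preferred chart. -/
theorem extDeriv_inChart_eq_zero [I.Boundaryless] {w : DiffForm I k F M} {x₀ : M} {u : E}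
    (hu : u ∈ (extChartAt I x₀).target) (hw : SmoothOn I w univ)
    (hd : extDer I w ((extChartAt I x₀).symm u) = 0) :
    extDeriv (inChart I w x₀) u = 0 := by
  -- The hypothesis `hd` concerns the chart at the moving point; writing the expression in the fixed
  -- chart as a pullback lets naturality compare them.
  have hp : pullback 𝓘(ℝ, E) I (extChartAt I x₀).symm w = inChart I w x₀ := by
    funext v
    rw [inChart, I.range_eq_univ, mfderivWithin_univ]
    rfl
  have hs : ContMDiffAt 𝓘(ℝ, E) I 2 (extChartAt I x₀).symm u :=
    (contMDiffOn_extChartAt_symm x₀).contMDiffAt (extChartAt_target_mem_nhds' hu)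
  have h := extDer_pullback hs (w := w) ((hw.contDiffAt_inChart isOpen_univ
    (mem_chart_source H _) (mem_univ _)).differentiableAt (by simp))
  rw [extDer_model, hp, hd] at h
  refine h.trans ?_
  ext v
  rfl

/-- Smooth closed forms are locally exact. -/
theorem exists_opens_extDer_eq [FiniteDimensional ℝ E] [CompleteSpace F] [I.Boundaryless]
    {w : DiffForm I (k + 1) F M} (hw : SmoothOn I w univ) (hd : ∀ x, extDer I w x = 0) (x₀ : M) :
    ∃ (U : TopologicalSpace.Opens M) (α : DiffForm I k F M), x₀ ∈ U ∧ SmoothOn I α U ∧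
      ∀ x ∈ U, extDer I α x = w x := by
  obtain ⟨r, hr, hrs, b, hb, hbw⟩ := exists_ball_contDiff_extDeriv_eq
    (w := inChart I w x₀) (s := (extChartAt I x₀).target) (c := extChartAt I x₀ x₀)
    (extChartAt_target_mem_nhds x₀)
    (fun u hu ↦ by
      have h := hw.contDiffAt_inChart isOpen_univ (x₀ := x₀) (y := (extChartAt I x₀).symm u)
        (by simpa only [extChartAt_source] using (extChartAt I x₀).map_target hu) (mem_univ _)
      rwa [(extChartAt I x₀).right_inv hu] at h)
    (fun u hu ↦ extDeriv_inChart_eq_zero hu hw (hd _))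
  refine ⟨⟨(extChartAt I x₀).source ∩ extChartAt I x₀ ⁻¹' Metric.ball (extChartAt I x₀ x₀) r,
    isOpen_extChartAt_preimage' x₀ Metric.isOpen_ball⟩, pullback I 𝓘(ℝ, E) (extChartAt I x₀) b,
    ⟨mem_extChartAt_source x₀, Metric.mem_ball_self hr⟩, fun x hx ↦ ?_, fun x hx ↦ ?_⟩
  · have hx' : x ∈ (chartAt H x₀).source := by simpa only [extChartAt_source] using hx.1
    refine ((contMDiffAt_section_iff_inChart hx').2 ?_).contMDiffWithinAt
    refine hb.contDiffAt.congr_of_eventuallyEq ?_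
    filter_upwards [extChartAt_target_mem_nhds' ((extChartAt I x₀).map_source hx.1)] with u hu
      using inChart_pullback_extChartAt b hu
  · have hx' : x ∈ (chartAt H x₀).source := by simpa only [extChartAt_source] using hx.1
    have hbx : DifferentiableAt ℝ (inChart 𝓘(ℝ, E) b (extChartAt I x₀ x)) (extChartAt I x₀ x) :=
      (congrArg (fun g : E → E [⋀^Fin k]→L[ℝ] F ↦ DifferentiableAt ℝ g (extChartAt I x₀ x))
        (inChart_model b _)).mpr (hb.contDiffAt.differentiableAt (by simp))
    -- With `φ` the chart at `x₀`: `d(φ^*b) = φ^*(db) = φ^*((φ⁻¹)^*w) = w`.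
    refine (extDer_pullback (w := b) (contMDiffAt_extChartAt' hx') hbx).trans ?_
    have h := (extDer_model b (extChartAt I x₀ x)).trans (hbw _ hx.2)
    ext v
    exact congr($h _).trans congr($(compContinuousLinearMap_inChart w hx.1) v)

/-- The canonical form is tautological: pulling it back under a form, viewed as a section,
gives back that form. -/
theorem pullback_section_canonicalTheta {α : DiffForm I k F M} {x : M}
    (hα : MDifferentiableAt I (formModel I k F) (fun y ↦ (⟨y, α y⟩ : FormBundle I k F M)) x) :
    pullback I (formModel I k F) (fun y ↦ (⟨y, α y⟩ : FormBundle I k F M))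
      (canonicalTheta I k F M) x = α x := by
  have h3 : MDifferentiableAt (formModel I k F) I (TotalSpace.proj : FormBundle I k F M → M)
      ⟨x, α x⟩ :=
    (contMDiffAt_proj (n := ∞) (FormSpace I k F : M → Type _)).mdifferentiableAt (by simp)
  -- Differentiating `π ∘ α = id` shows that `π_*` undoes the derivative of the section.
  have h4 := h3.hasMFDerivAt.comp x hα.hasMFDerivAt
  have h5 := hasMFDerivAt_unique h4 (hasMFDerivAt_id x)
  ext v
  change α x _ = α x _
  congr 1
  funext i
  exact congr($h5 (v i))

/-- Pulling back `Ω = dΘ` under a form, viewed as a section, gives its exterior derivative. -/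
theorem extDer_eq_canonicalOmega_comp [I.Boundaryless] {α : DiffForm I k F M} {s : Set M}
    (hs : IsOpen s) (hα : SmoothOn I α s) {x : M} (hx : x ∈ s) :
    extDer I α x = (canonicalOmega I k F M ⟨x, α x⟩).compContinuousLinearMap
      (mfderiv I (formModel I k F) (fun y ↦ (⟨y, α y⟩ : FormBundle I k F M)) x) := by
  have hαx (y : M) (hy : y ∈ s) : ContMDiffAt I (formModel I k F) ∞
      (fun y ↦ (⟨y, α y⟩ : FormBundle I k F M)) y := (hα y hy).contMDiffAt (hs.mem_nhds hy)
  have h : ∀ᶠ y in 𝓝 x, pullback I (formModel I k F) (fun y ↦ (⟨y, α y⟩ : FormBundle I k F M))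
      (canonicalTheta I k F M) y = α y := by
    filter_upwards [hs.mem_nhds hx] with y hy
      using pullback_section_canonicalTheta ((hαx y hy).mdifferentiableAt (by simp))
  -- The tautological identity is known only on `s`; locality of `d` makes that enough.
  rw [← extDer_congr h]
  exact extDer_pullback ((hαx x hx).of_le ENat.LEInfty.out)
    ((contDiffAt_inChart_canonicalTheta _).differentiableAt (by simp))

end Multisymplectic

theorem theorem2p1 (n k m : ℕ) (hn : 2 ≤ n) (hk : 1 ≤ k) (hkn : k ≤ n - 1)
    (M : Type*) [TopologicalSpace M] [ChartedSpace (EuclideanSpace ℝ (Fin n)) M]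
    [IsManifold (𝓡 n) ∞ M]
    (w : DiffForm (𝓡 n) (k + 1) (EuclideanSpace ℝ (Fin m)) M)
    (hw : IsPlectic (𝓡 n) w) (x₀ : M) :
    ∃ (U : TopologicalSpace.Opens M) (α : DiffForm (𝓡 n) k (EuclideanSpace ℝ (Fin m)) M)
      (f : U → FormBundle (𝓡 n) k (EuclideanSpace ℝ (Fin m)) M),
      x₀ ∈ U ∧
      SmoothOn (𝓡 n) α U ∧
      (∀ x ∈ U, extDer (𝓡 n) α x = w x) ∧
      (∀ x : U, f x = ⟨x, α x⟩) ∧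
      IsSmoothEmbedding (𝓡 n) (formModel (𝓡 n) k (EuclideanSpace ℝ (Fin m))) ∞ f ∧
      pullback (𝓡 n) (𝓡 n) (Subtype.val : U → M) w =
        pullback (𝓡 n) (formModel (𝓡 n) k (EuclideanSpace ℝ (Fin m))) f
          (canonicalOmega (𝓡 n) k (EuclideanSpace ℝ (Fin m)) M) := by
  obtain ⟨U, α, hx₀, hα, hαw⟩ := exists_opens_extDer_eq hw.smooth hw.closed x₀
  refine ⟨U, α, fun x ↦ ⟨x, α x⟩, hx₀, hα, hαw, fun _ ↦ rfl, isSmoothEmbedding_section hα, ?_⟩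
  funext x
  have h1 := ((hα x x.2).contMDiffAt (U.isOpen.mem_nhds x.2)).mdifferentiableAt (by simp)
  have h2 : MDifferentiableAt (𝓡 n) (𝓡 n) (Subtype.val : U → M) x :=
    contMDiff_subtype_val.contMDiffAt.mdifferentiableAt (n := ∞) (by simp)
  -- The map `f` is the section on `M` composed with the inclusion of `U`, so the identity on `M` is
  -- evaluated on vectors pushed forward by the inclusion.
  have h3 := mfderiv_comp x h1 h2
  have h4 := (hαw x x.2).symm.trans (extDer_eq_canonicalOmega_comp U.isOpen hα x.2)
  refine ContinuousAlternatingMap.ext fun v ↦ ?_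
  refine congr($h4 (fun i ↦ mfderiv (𝓡 n) (𝓡 n) (Subtype.val : U → M) x (v i))).trans ?_
  change canonicalOmega (𝓡 n) k (EuclideanSpace ℝ (Fin m)) M ⟨x, α x⟩ _ =
    canonicalOmega (𝓡 n) k (EuclideanSpace ℝ (Fin m)) M ⟨x, α x⟩ _
  congr 1
  funext i
  exact congr($h3 (v i)).symm
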